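/- **Theorem 1.1.** Let $\{b_n\}_{n=1}^\infty$ and $\{d_n\}_{n=1}^\infty$ be sequences of positive integers such that for all $n\ge 1$ $$1<d_n<b_n \quad\text{and}\quad 2\le \frac{b_n}{d_n}\in\mathbb Z .$$ Put $\rho_1=1$ and $\rho_n=\prod_{j=1}^{n-1}b_j$ for $n\ge 2$, and $H_m(\xi)=\frac1m\sum_{j=0}^{m-1}e^{-2\pi i j\xi}$ for $m\ge 1$. There is exactly one probability measure $\mu=\mu_{\mathcal B,\mathcal D}$ on $\mathbb R$ (the Riesz product measure) whose Fourier transform is given by a convergent product $$\int_{\mathbb R}e^{-2\pi i\xi x}\,d\mu(x)=\prod_{n=1}^\infty H_{d_n}\Big(\frac{\xi}{d_n\rho_n}\Big)\qquad\text{for all }\xi\in\mathbb R ,$$ and the set $$\Lambda_{\mathcal B,\mathcal D}=\bigcup_{L=1}^\infty\Big(\sum_{n=1}^{L}\big([0,d_n)\cap\mathbb Z\big)\rho_n\Big)=\bigcup_{L=1}^\infty\Big\{\sum_{n=1}^L\delta_n\rho_n:\ \delta_n\in\{0,1,\dots,d_n-1\}\Big\}$$ is a spectrum of $\mu_{\mathcal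 B,\mathcal D}$. That is, $\mu_{\mathcal B,\mathcal D}$ has compact support, $\Lambda_{\mathcal B,\mathcal D}$ is countable, and the functions $x\mapsto e^{-2\pi i\lambda x}$, $\lambda\in\Lambda_{\mathcal B,\mathcal D}$, form an orthonormal basis of $L^2(\mu_{\mathcal B,\mathcal D})$. -/

import Mathlib

open MeasureTheory

namespace RieszSpectral

/-- `rho b n = b 0 * ⋯ * b (n - 1)`. Sequences are indexed from `0`: the `n`-th term here is the
term of index `n + 1` of a sequence indexed by the positive integers. -/
def rho (b : ℕ → ℕ) (n : ℕ) : ℕ := ∏ j ∈ Finset.range n, b j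

/-- The Fourier transform `ξ ↦ ∫ exp (-2πi ξ x) dμ(x)` of a measure on the real line. -/
noncomputable def fourierTransform (μ : Measure ℝ) (ξ : ℝ) : ℂ :=
  ∫ x : ℝ, Complex.exp (-2 * Real.pi * Complex.I * ξ * x) ∂μ

/-- The trigonometric polynomial `H_m(ξ) = (1/m) ∑_{j=0}^{m-1} exp (-2πi j ξ)`. -/
noncomputable def H (m : ℕ) (ξ : ℝ) : ℂ :=
  (1 / (m : ℂ)) * ∑ j ∈ Finset.range m, Complex.exp (-2 * Real.pi * Complex.I * j * ξ)

/-- `μ` is the Riesz product measure of the sequences `b`, `d`: it is a probability measure whose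
Fourier transform at every real `ξ` is the (convergent) product of `H_{d_n}(ξ / (d_n ρ_n))`. -/
def IsRieszProductMeasure (b d : ℕ → ℕ) (μ : Measure ℝ) : Prop :=
  IsProbabilityMeasure μ ∧
    ∀ ξ : ℝ, HasProd (fun n : ℕ => H (d n) (ξ / ((d n : ℝ) * (rho b n : ℝ))))
      (fourierTransform μ ξ)

/-- `Λ` is a spectrum of `μ`: `μ` is a probability measure with compact support, `Λ` is countable,
and the exponentials `x ↦ exp (-2πi l x)`, `l ∈ Λ`, form an orthonormal (Hilbert) basis of
`L²(μ)`. -/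
def IsSpectrum (μ : Measure ℝ) (Λ : Set ℝ) : Prop :=
  IsProbabilityMeasure μ ∧ IsCompact μ.support ∧ Λ.Countable ∧
    ∃ e : HilbertBasis Λ ℂ (Lp ℂ 2 μ),
      ∀ l : Λ, (e l : ℝ → ℂ) =ᵐ[μ]
        fun x : ℝ => Complex.exp (-2 * Real.pi * Complex.I * ((l : ℝ) : ℂ) * (x : ℂ))

/-- The union over `L ≥ 1` of the sets of all sums `∑_{n < L} δ_n ρ_n` with integer digits
`0 ≤ δ_n < d_n`. -/
def spectralSet (b d : ℕ → ℕ) : Set ℝ :=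
  ⋃ L ∈ Set.Ici (1 : ℕ), {x : ℝ | ∃ δ : ℕ → ℕ, (∀ n < L, δ n < d n) ∧
    x = ∑ n ∈ Finset.range L, (δ n : ℝ) * (rho b n : ℝ)}

end RieszSpectral

open scoped InnerProductSpace ComplexConjugate Topology

namespace RieszSpectral

/-! The measure is the law of a random series with independent terms `j / (d n * rho b n)`, `j`
uniform on `0, …, d n - 1`. Independence turns its Fourier transform into the product, and
characteristic functions give uniqueness.

Let `P_L` be the product of the first `L` factors. Parseval for each `H` and the `rho b
L`-periodicity of `P_L` give `∑ |P_L(ξ + l)|² = 1` over the digit sums `l` of length `L`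
(`sum_normSq_partialProd`). At `ξ = -l'` this forces orthogonality.

For completeness, let `L → ∞` to obtain Parseval's identity for every exponential `expLp μ x`
(`hasSum_normSq_inner_expLp`). A digit sum is at most `rho b L / 2`, so for large `L` the arguments
stay within `3 / 5 * rho b L`. There the missing factors cost at most a factor `5`
(`norm_partialProd_le`), so dominated convergence applies. Exponentials of all real frequencies are
total in `L²`, which finishes the proof. -/

/-! ### The trigonometric polynomials `H m`. -/

lemma norm_cexp_neg_two_pi_I_mul (x : ℝ) :
    ‖Complex.exp (-2 * Real.pi * Complex.I * x)‖ = 1 := by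
  rw [show -2 * Real.pi * Complex.I * (x : ℂ) = ((-2 * Real.pi * x : ℝ) : ℂ) * Complex.I by
    push_cast; ring]
  exact Complex.norm_exp_ofReal_mul_I _

lemma H_zero {m : ℕ} (hm : m ≠ 0) : H m 0 = 1 := by
  simp [H, hm]

lemma H_add_int (m : ℕ) (ξ : ℝ) (k : ℤ) : H m (ξ + k) = H m ξ := by
  unfold H
  congr 1
  refine Finset.sum_congr rfl fun j _ => ?_
  rw [Complex.exp_eq_exp_iff_exists_int]
  refine ⟨-(j * k), ?_⟩
  push_cast
  ring

lemma norm_H_le_one (m : ℕ) (ξ : ℝ) : ‖H m ξ‖ ≤ 1 := by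
  unfold H
  rcases Nat.eq_zero_or_pos m with rfl | hm
  · simp
  have hm' : (0 : ℝ) < m := by exact_mod_cast hm
  have h : ‖∑ j ∈ Finset.range m, Complex.exp (-2 * Real.pi * Complex.I * j * ξ)‖ ≤ m := by
    refine (norm_sum_le _ _).trans ?_
    have : ∀ j ∈ Finset.range m, ‖Complex.exp (-2 * Real.pi * Complex.I * j * ξ)‖ = 1 := by
      intro j _
      have := norm_cexp_neg_two_pi_I_mul (j * ξ)
      push_cast at this
      rwa [← mul_assoc] at this
    rw [Finset.sum_congr rfl this]
    simp
  rw [norm_mul, norm_div, norm_one, Complex.norm_natCast, one_div, inv_mul_le_iff₀ hm']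
  simpa using h

lemma sum_exp_root {m : ℕ} (hm : m ≠ 0) {i j : ℕ} (hi : i < m) (hj : j < m) :
    ∑ k ∈ Finset.range m, Complex.exp (2 * Real.pi * Complex.I * ((i : ℂ) - j) * (k / m)) =
      if i = j then (m : ℂ) else 0 := by
  have hm' : (m : ℂ) ≠ 0 := by exact_mod_cast hm
  have hζ := Complex.isPrimitiveRoot_exp m hm
  set ζ := Complex.exp (2 * Real.pi * Complex.I / m) with hζd
  have hpow : ∀ k : ℕ, Complex.exp (2 * Real.pi * Complex.I * ((i : ℂ) - j) * (k / m)) =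
      (ζ ^ ((i : ℤ) - j)) ^ k := by
    intro k
    rw [hζd, ← Complex.exp_int_mul, ← Complex.exp_nat_mul]
    congr 1
    push_cast
    ring
  simp_rw [hpow]
  split_ifs with h
  · simp [h]
  · have hne : ζ ^ ((i : ℤ) - j) ≠ 1 := by
      rw [Ne, hζ.zpow_eq_one_iff_dvd]
      intro hd
      have := Int.eq_zero_of_abs_lt_dvd hd (by rw [abs_lt]; constructor <;> omega)
      omega
    rw [geom_sum_eq hne, ← zpow_natCast, ← zpow_mul, mul_comm, zpow_mul, zpow_natCast,
      hζ.pow_eq_one]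
    simp

/-- Expand the square as a double sum over `i, j`; summing over `k` kills the off-diagonal terms by
orthogonality of the characters of `ℤ/m`. -/
lemma sum_normSq_H {m : ℕ} (hm : m ≠ 0) (s : ℝ) :
    ∑ k ∈ Finset.range m, ‖H m (s + k / m)‖ ^ 2 = 1 := by
  have hm' : (m : ℂ) ≠ 0 := by exact_mod_cast hm
  have key : ∀ k : ℕ, ((‖H m (s + k / m)‖ ^ 2 : ℝ) : ℂ) = (1 / (m : ℂ)) ^ 2 *
      ∑ i ∈ Finset.range m, ∑ j ∈ Finset.range m,
        Complex.exp (2 * Real.pi * Complex.I * ((i : ℂ) - j) * s) *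
          Complex.exp (2 * Real.pi * Complex.I * ((i : ℂ) - j) * (k / m)) := by
    intro k
    push_cast
    rw [← Complex.conj_mul', H, map_mul, map_sum]
    rw [mul_mul_mul_comm, Finset.sum_mul_sum]
    congr 1
    · simp [sq]
    refine Finset.sum_congr rfl fun i _ => Finset.sum_congr rfl fun j _ => ?_
    rw [← Complex.exp_conj, ← Complex.exp_add, ← Complex.exp_add]
    congr 1
    simp [show (starRingEnd ℂ) 2 = 2 from Complex.conj_ofNat 2]
    ring
  have : ((∑ k ∈ Finset.range m, ‖H m (s + k / m)‖ ^ 2 : ℝ) : ℂ) = 1 := by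
    rw [Complex.ofReal_sum, Finset.sum_congr rfl fun k _ => key k, ← Finset.mul_sum,
      Finset.sum_comm]
    have : ∀ i ∈ Finset.range m, ∑ k ∈ Finset.range m, ∑ j ∈ Finset.range m,
        Complex.exp (2 * Real.pi * Complex.I * ((i : ℂ) - j) * s) *
          Complex.exp (2 * Real.pi * Complex.I * ((i : ℂ) - j) * (k / m)) = m := by
      intro i hi
      rw [Finset.sum_comm]
      simp_rw [← Finset.mul_sum]
      rw [Finset.sum_congr rfl fun j hj => by
        rw [sum_exp_root hm (Finset.mem_range.1 hi) (Finset.mem_range.1 hj)]]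
      simp [Finset.mem_range.1 hi]
    rw [Finset.sum_congr rfl this]
    simp
    field_simp
  exact_mod_cast this

lemma sum_range_sub_center_sq (m : ℕ) :
    ∑ j ∈ Finset.range m, ((j : ℝ) - (m - 1) / 2) ^ 2 = m * ((m : ℝ) ^ 2 - 1) / 12 := by
  have h : ∀ (n : ℕ) (c : ℝ), ∑ j ∈ Finset.range n, ((j : ℝ) - c) ^ 2 =
      n * (n - 1) * (2 * n - 1) / 6 - c * n * (n - 1) + n * c ^ 2 := by
    intro n c
    induction n with
    | zero => simp
    | succ n ih => rw [Finset.sum_range_succ, ih]; push_cast; ring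
  rw [h]
  ring

/-- Multiplying by a phase centres the frequencies at `(m - 1) / 2`. Then `cos θ ≥ 1 - θ² / 2` and
the variance of a uniform digit give a bound uniform in `m`. -/
lemma one_sub_le_norm_H {m : ℕ} (hm : m ≠ 0) (t : ℝ) :
    1 - Real.pi ^ 2 * t ^ 2 / 6 ≤ ‖H m (t / m)‖ := by
  have hm' : (0 : ℝ) < m := by exact_mod_cast Nat.pos_of_ne_zero hm
  set c : ℝ := ((m : ℝ) - 1) / 2 with hc
  have hrot : (m : ℂ) * (Complex.exp (-2 * Real.pi * Complex.I * ((-c * (t / m) : ℝ) : ℂ)) *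
      H m (t / m)) =
      ∑ j ∈ Finset.range m, Complex.exp (((-2 * Real.pi * ((j - c) * (t / m)) : ℝ) : ℂ) *
        Complex.I) := by
    rw [H, mul_left_comm, ← mul_assoc (m : ℂ), mul_one_div_cancel (by exact_mod_cast hm), one_mul,
      Finset.mul_sum]
    refine Finset.sum_congr rfl fun j _ => ?_
    rw [← Complex.exp_add]
    congr 1
    push_cast
    ring
  have hre : (∑ j ∈ Finset.range m, Complex.exp (((-2 * Real.pi * ((j - c) * (t / m)) : ℝ) : ℂ) *
        Complex.I)).re = ∑ j ∈ Finset.range m, Real.cos (-2 * Real.pi * ((j - c) * (t / m))) := by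
    rw [Complex.re_sum]
    exact Finset.sum_congr rfl fun j _ => Complex.exp_ofReal_mul_I_re _
  have hlow : (m : ℝ) * (1 - Real.pi ^ 2 * t ^ 2 / 6) ≤
      ∑ j ∈ Finset.range m, Real.cos (-2 * Real.pi * ((j - c) * (t / m))) := by
    have h1 : ∑ j ∈ Finset.range m, (1 - (-2 * Real.pi * (((j : ℝ) - c) * (t / m))) ^ 2 / 2) ≤
        ∑ j ∈ Finset.range m, Real.cos (-2 * Real.pi * ((j - c) * (t / m))) :=
      Finset.sum_le_sum fun j _ => Real.one_sub_sq_div_two_le_cos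
    refine le_trans ?_ h1
    have h2 : ∀ j : ℕ, (1 - (-2 * Real.pi * (((j : ℝ) - c) * (t / m))) ^ 2 / 2) =
        1 - (2 * Real.pi ^ 2 * t ^ 2 / m ^ 2) * ((j : ℝ) - c) ^ 2 := by
      intro j
      field_simp
    simp_rw [h2]
    rw [Finset.sum_sub_distrib, ← Finset.mul_sum, hc, sum_range_sub_center_sq]
    simp only [Finset.sum_const, Finset.card_range, nsmul_eq_mul, mul_one]
    have h3 : 2 * Real.pi ^ 2 * t ^ 2 / m ^ 2 * (m * ((m : ℝ) ^ 2 - 1) / 12) =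
      m * (Real.pi ^ 2 * t ^ 2 / 6) - Real.pi ^ 2 * t ^ 2 / (6 * m) := by
      field_simp
      ring
    rw [h3]
    have : 0 ≤ Real.pi ^ 2 * t ^ 2 / (6 * m) := by positivity
    linarith
  have hn := Complex.re_le_norm (∑ j ∈ Finset.range m,
    Complex.exp (((-2 * Real.pi * ((j - c) * (t / m)) : ℝ) : ℂ) * Complex.I))
  rw [hre, ← hrot, norm_mul, norm_mul, norm_cexp_neg_two_pi_I_mul, Complex.norm_natCast,
    one_mul] at hn
  exact le_of_mul_le_mul_left (hlow.trans hn) hm'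

/-! ### Finite products and digit sums. -/

/-- The conditions on the sequences `b` and `d`: `1 < d n` and `b n` is a multiple of `d n` with
quotient at least `2`. -/
structure Admissible (b d : ℕ → ℕ) : Prop where
  one_lt : ∀ n, 1 < d n
  dvd : ∀ n, d n ∣ b n
  two_mul_le : ∀ n, 2 * d n ≤ b n

/-- The product of the first `N` factors of the Fourier transform. -/
noncomputable def partialProd (b d : ℕ → ℕ) (N : ℕ) (ξ : ℝ) : ℂ :=
  ∏ n ∈ Finset.range N, H (d n) (ξ / ((d n : ℝ) * (rho b n : ℝ)))

/-- The sums `∑_{n < L} δ_n ρ_n` with digits `0 ≤ δ_n < d_n`. -/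
def digitSums (b d : ℕ → ℕ) : ℕ → Finset ℕ
  | 0 => {0}
  | L + 1 => (digitSums b d L ×ˢ Finset.range (d L)).image fun p => p.1 + p.2 * rho b L

lemma rho_succ (b : ℕ → ℕ) (n : ℕ) : rho b (n + 1) = rho b n * b n :=
  Finset.prod_range_succ _ _

lemma partialProd_succ (b d : ℕ → ℕ) (n : ℕ) (ξ : ℝ) : partialProd b d (n + 1) ξ =
    partialProd b d n ξ * H (d n) (ξ / ((d n : ℝ) * (rho b n : ℝ))) :=
  Finset.prod_range_succ _ _

variable {b d : ℕ → ℕ}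

namespace Admissible

lemma pos (h : Admissible b d) (n : ℕ) : 0 < d n := zero_lt_one.trans (h.one_lt n)

lemma four_le (h : Admissible b d) (n : ℕ) : 4 ≤ b n := by
  have := h.one_lt n
  have := h.two_mul_le n
  omega

lemma rho_pos (h : Admissible b d) (n : ℕ) : 0 < rho b n :=
  Finset.prod_pos fun i _ => by have := h.four_le i; omega

lemma four_pow_mul_rho_le (h : Admissible b d) (L k : ℕ) :
    4 ^ k * rho b L ≤ rho b (L + k) := by
  induction k with
  | zero => simp
  | succ k ih =>
    rw [← add_assoc, rho_succ, pow_succ, mul_right_comm]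
    exact Nat.mul_le_mul ih (h.four_le _)

/-- The integrality of `b n / d n` enters here; it makes the first `L` factors `rho b L`-periodic.
-/
lemma mul_rho_dvd_rho (h : Admissible b d) {n L : ℕ} (hn : n < L) : d n * rho b n ∣ rho b L := by
  have h1 : rho b (n + 1) ∣ rho b L :=
    Finset.prod_dvd_prod_of_subset _ _ _ (Finset.range_subset_range.2 hn)
  refine dvd_trans ?_ h1
  rw [rho_succ, mul_comm]
  exact mul_dvd_mul_left _ (h.dvd n)

/-- The room left by the factor `1 / 2` is what later keeps translates `l - x` within `3 / 5 * rho b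
L`. -/
lemma two_mul_le_rho (h : Admissible b d) {L l : ℕ} (hl : l ∈ digitSums b d L) :
    2 * l ≤ rho b L := by
  induction L generalizing l with
  | zero => simp_all [digitSums]
  | succ L ih =>
    simp only [digitSums, Finset.mem_image, Finset.mem_product, Finset.mem_range, Prod.exists] at hl
    obtain ⟨a, k, ⟨ha, hk⟩, rfl⟩ := hl
    have h1 := ih ha
    rw [rho_succ]
    have h2 : (2 * k + 1) ≤ b L := by have := h.two_mul_le L; omega
    calc 2 * (a + k * rho b L) ≤ rho b L * (2 * k + 1) := by nlinarith
      _ ≤ _ := Nat.mul_le_mul_left _ h2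

lemma lt_rho (h : Admissible b d) {L l : ℕ} (hl : l ∈ digitSums b d L) : l < rho b L := by
  have := h.two_mul_le_rho hl
  have := h.rho_pos L
  omega

lemma digitSums_mono (h : Admissible b d) : Monotone (digitSums b d) := by
  refine monotone_nat_of_le_succ fun L l hl => ?_
  simp only [digitSums, Finset.mem_image, Finset.mem_product, Finset.mem_range, Prod.exists]
  exact ⟨l, 0, ⟨hl, h.pos L⟩, by simp⟩

/-- Digits are unique: since `l < rho b L`, the pair `(l, k)` is recovered as remainder and quotient
modulo `rho b L`. -/
lemma sum_digitSums_succ (h : Admissible b d) (L : ℕ) (f : ℕ → ℝ) :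
    ∑ l ∈ digitSums b d (L + 1), f l =
      ∑ l ∈ digitSums b d L, ∑ k ∈ Finset.range (d L), f (l + k * rho b L) := by
  rw [digitSums, Finset.sum_image, Finset.sum_product]
  rintro ⟨a, k⟩ ha ⟨a', k'⟩ ha' heq
  simp only [Finset.coe_product, Set.mem_prod, Finset.mem_coe] at ha ha'
  have h1 := h.lt_rho ha.1
  have h2 := h.lt_rho ha'.1
  simp only at heq
  have hm := congrArg (· % rho b L) heq
  have hd := congrArg (· / rho b L) heq
  simp only [Nat.add_mul_mod_self_right, Nat.mod_eq_of_lt h1, Nat.mod_eq_of_lt h2] at hm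
  simp only [Nat.add_mul_div_right _ _ (h.rho_pos L), Nat.div_eq_of_lt h1,
    Nat.div_eq_of_lt h2, zero_add] at hd
  rw [hm, hd]

lemma partialProd_add_mul_rho (h : Admissible b d) (L : ℕ) (ξ : ℝ) (k : ℕ) :
    partialProd b d L (ξ + k * rho b L) = partialProd b d L ξ := by
  refine Finset.prod_congr rfl fun n hn => ?_
  obtain ⟨c, hc⟩ := h.mul_rho_dvd_rho (Finset.mem_range.1 hn)
  have h1 : (d n : ℝ) * rho b n ≠ 0 := by
    exact_mod_cast (Nat.mul_pos (h.pos n) (h.rho_pos n)).ne'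
  have h2 : (rho b L : ℝ) = d n * rho b n * c := by exact_mod_cast hc
  have h3 : (ξ + k * rho b L) / ((d n : ℝ) * rho b n) =
      ξ / ((d n : ℝ) * rho b n) + ((k * c : ℕ) : ℤ) := by
    rw [h2, add_div]
    congr 1
    push_cast
    have h4 : (d n : ℝ) ≠ 0 := left_ne_zero_of_mul h1
    have h5 : (rho b n : ℝ) ≠ 0 := right_ne_zero_of_mul h1
    field_simp
  rw [h3, H_add_int]

/-- The top digit `k` does not change the first `L` factors and shifts the argument of the last one
by `k / d L`, so `sum_normSq_H` sums it out. -/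
lemma sum_normSq_partialProd (h : Admissible b d) (L : ℕ) (ξ : ℝ) :
    ∑ l ∈ digitSums b d L, ‖partialProd b d L (ξ + l)‖ ^ 2 = 1 := by
  induction L with
  | zero => simp [digitSums, partialProd]
  | succ L ih =>
    rw [h.sum_digitSums_succ, ← ih]
    refine Finset.sum_congr rfl fun l _ => ?_
    have hr : (rho b L : ℝ) ≠ 0 := by exact_mod_cast (h.rho_pos L).ne'
    have hd : (d L : ℝ) ≠ 0 := by exact_mod_cast (h.pos L).ne'
    have h1 : ∀ k ∈ Finset.range (d L),
        ‖partialProd b d (L + 1) (ξ + ((l + k * rho b L : ℕ) : ℝ))‖ ^ 2 =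
        ‖partialProd b d L (ξ + l)‖ ^ 2 *
          ‖H (d L) ((ξ + l) / ((d L : ℝ) * rho b L) + k / d L)‖ ^ 2 := by
      intro k _
      rw [partialProd_succ, norm_mul, mul_pow]
      congr 3
      · rw [← h.partialProd_add_mul_rho L (ξ + l) k]
        push_cast
        ring_nf
      · congr 1
        push_cast
        field_simp
        ring
    rw [Finset.sum_congr rfl h1, ← Finset.mul_sum, sum_normSq_H (h.pos L).ne', mul_one]

/-- At `ξ = -l'` the term of `l'` is already `1`, so the other nonnegative terms vanish. -/
lemma partialProd_sub_eq_zero (h : Admissible b d) {L l l' : ℕ} (hl : l ∈ digitSums b d L)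
    (hl' : l' ∈ digitSums b d L) (hne : l ≠ l') : partialProd b d L ((l : ℝ) - l') = 0 := by
  have h1 := h.sum_normSq_partialProd L (-(l' : ℝ))
  rw [← Finset.add_sum_erase _ _ hl'] at h1
  have h2 : partialProd b d L (-(l' : ℝ) + l') = 1 := by
    rw [neg_add_cancel]
    exact Finset.prod_eq_one fun n _ => by rw [zero_div, H_zero (h.pos n).ne']
  rw [h2, norm_one, one_pow, add_eq_left, Finset.sum_eq_zero_iff_of_nonneg
    fun _ _ => by positivity] at h1
  have h3 := h1 l (Finset.mem_erase.2 ⟨hne, hl⟩)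
  rw [neg_add_eq_sub] at h3
  simpa using h3

/-- The factors of index at least `L` only matter up to a constant at distance at most
`3 / 5 * ρ_L` from the origin. -/
lemma mul_norm_partialProd_le (h : Admissible b d) (L : ℕ) {x : ℝ}
    (hx : |x| ≤ 3 / 5 * rho b L) (k : ℕ) :
    (1 / 5 + 2 / 5 * (1 / 16) ^ k) * ‖partialProd b d L x‖ ≤ ‖partialProd b d (L + k) x‖ := by
  have hr : (0 : ℝ) < rho b L := by exact_mod_cast h.rho_pos L
  induction k with
  | zero =>
    have := norm_nonneg (partialProd b d L x)
    simp
    linarith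
  | succ k ih =>
    have hr' : (0 : ℝ) < rho b (L + k) := by exact_mod_cast h.rho_pos (L + k)
    have h4 : (4 : ℝ) ^ k * rho b L ≤ rho b (L + k) := by
      exact_mod_cast h.four_pow_mul_rho_le L k
    have hq : |x / rho b (L + k)| ≤ 3 / 5 * (1 / 4) ^ k := by
      rw [abs_div, abs_of_pos hr', div_le_iff₀ hr']
      calc |x| ≤ 3 / 5 * rho b L := hx
        _ = 3 / 5 * (1 / 4) ^ k * (4 ^ k * rho b L) := by
          rw [one_div, inv_pow]; field_simp
        _ ≤ _ := by gcongr
    have hsq : (x / rho b (L + k)) ^ 2 ≤ 9 / 25 * (1 / 16) ^ k := by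
      rw [← sq_abs]
      calc |x / rho b (L + k)| ^ 2 ≤ (3 / 5 * (1 / 4) ^ k) ^ 2 := by gcongr
        _ = _ := by
          rw [mul_pow, ← pow_mul, mul_comm k, pow_mul]; norm_num
    have hpi : Real.pi ^ 2 ≤ 10 := by
      have := Real.pi_lt_d2
      have := Real.pi_pos
      nlinarith
    have hH := one_sub_le_norm_H (h.pos (L + k)).ne' (x / rho b (L + k))
    rw [div_div, mul_comm (rho b (L + k) : ℝ)] at hH
    have hy : (0 : ℝ) < (1 / 16) ^ k := by positivity
    have hy1 : (1 / 16 : ℝ) ^ k ≤ 1 := pow_le_one₀ (by norm_num) (by norm_num)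
    -- The constant is `10 * (9 / 25) / 6 = 3 / 5`.
    have hH' : 1 - 3 / 5 * (1 / 16) ^ k ≤
        ‖H (d (L + k)) (x / ((d (L + k) : ℝ) * rho b (L + k)))‖ := by
      refine le_trans ?_ hH
      have : Real.pi ^ 2 * (x / rho b (L + k)) ^ 2 ≤ 10 * (9 / 25 * (1 / 16) ^ k) := by gcongr
      linarith
    rw [← add_assoc, partialProd_succ, norm_mul]
    have hA := norm_nonneg (partialProd b d L x)
    -- With `y = (1 / 16) ^ k ≤ 1`, `(1/5 + 2y/5)(1 - 3y/5) ≥ 1/5 + y/25`, which exceeds the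
    -- required `1/5 + y/40`.
    calc (1 / 5 + 2 / 5 * (1 / 16) ^ (k + 1)) * ‖partialProd b d L x‖
        ≤ ((1 / 5 + 2 / 5 * (1 / 16) ^ k) * ‖partialProd b d L x‖) *
            (1 - 3 / 5 * (1 / 16) ^ k) := by
          rw [mul_right_comm]
          refine mul_le_mul_of_nonneg_right ?_ hA
          rw [pow_succ]
          nlinarith
      _ ≤ _ := mul_le_mul ih hH' (by linarith) (norm_nonneg _)

lemma norm_partialProd_add_le (L k : ℕ) (x : ℝ) :
    ‖partialProd b d (L + k) x‖ ≤ ‖partialProd b d L x‖ := by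
  induction k with
  | zero => simp
  | succ k ih =>
    rw [← add_assoc, partialProd_succ, norm_mul]
    exact (mul_le_of_le_one_right (norm_nonneg _) (norm_H_le_one _ _)).trans ih

lemma mem_digitSums_iff {L l : ℕ} : l ∈ digitSums b d L ↔
    ∃ δ : ℕ → ℕ, (∀ n < L, δ n < d n) ∧ l = ∑ n ∈ Finset.range L, δ n * rho b n := by
  induction L generalizing l with
  | zero => simp [digitSums]
  | succ L ih =>
    simp only [digitSums, Finset.mem_image, Finset.mem_product, Finset.mem_range, Prod.exists]
    constructor
    · rintro ⟨a, k, ⟨ha, hk⟩, rfl⟩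
      obtain ⟨δ, hδ, rfl⟩ := ih.1 ha
      refine ⟨Function.update δ L k, fun n hn => ?_, ?_⟩
      · rcases eq_or_ne n L with rfl | hne
        · simpa using hk
        · simpa [hne] using hδ n (by omega)
      · rw [Finset.sum_range_succ, Function.update_self]
        congr 1
        refine Finset.sum_congr rfl fun n hn => ?_
        rw [Function.update_of_ne (Finset.mem_range.1 hn).ne]
    · rintro ⟨δ, hδ, rfl⟩
      exact ⟨_, δ L, ⟨ih.2 ⟨δ, fun n hn => hδ n (by omega), rfl⟩, hδ L (by omega)⟩,
        (Finset.sum_range_succ _ _).symm⟩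

lemma mem_spectralSet_iff (h : Admissible b d) {x : ℝ} :
    x ∈ spectralSet b d ↔ ∃ L, ∃ l ∈ digitSums b d L, x = (l : ℝ) := by
  simp only [spectralSet, Set.mem_iUnion, Set.mem_Ici, Set.mem_ofPred_eq, exists_prop]
  constructor
  · rintro ⟨L, -, δ, hδ, rfl⟩
    exact ⟨L, _, mem_digitSums_iff.2 ⟨δ, hδ, rfl⟩, by push_cast; rfl⟩
  · rintro ⟨L, l, hl, rfl⟩
    obtain ⟨δ, hδ, hl⟩ := mem_digitSums_iff.1 (h.digitSums_mono L.le_succ hl)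
    exact ⟨L + 1, by omega, δ, hδ, by rw [hl]; push_cast; rfl⟩

end Admissible

/-! ### Existence and uniqueness of the Riesz product measure. -/

lemma fourierTransform_eq_charFun (μ : Measure ℝ) (ξ : ℝ) :
    fourierTransform μ ξ = charFun μ (-2 * Real.pi * ξ) := by
  rw [fourierTransform, charFun_apply_real]
  congr with x
  push_cast
  ring_nf

lemma eq_of_fourierTransform_eq {μ ν : Measure ℝ} [IsFiniteMeasure μ] [IsFiniteMeasure ν]
    (h : ∀ ξ, fourierTransform μ ξ = fourierTransform ν ξ) : μ = ν := by
  refine Measure.ext_of_charFun (funext fun t => ?_)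
  have := h (-t / (2 * Real.pi))
  rw [fourierTransform_eq_charFun, fourierTransform_eq_charFun] at this
  have hp := Real.pi_pos.ne'
  rwa [show -2 * Real.pi * (-t / (2 * Real.pi)) = t by field_simp] at this

/-- The uniform distribution on `{0, …, m - 1}`. -/
noncomputable def uniformDigit (m : ℕ) : Measure ℕ :=
  (m : ENNReal)⁻¹ • ∑ j ∈ Finset.range m, Measure.dirac j

instance (m : ℕ) [NeZero m] : IsProbabilityMeasure (uniformDigit m) := by
  refine ⟨?_⟩
  simp only [uniformDigit, Measure.smul_apply, Measure.finsetSum_apply, measure_univ]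
  simp [ENNReal.inv_mul_cancel (Nat.cast_ne_zero.2 (NeZero.ne m))]

lemma integral_uniformDigit (m : ℕ) (f : ℕ → ℂ) :
    ∫ j, f j ∂uniformDigit m = (1 / (m : ℂ)) * ∑ j ∈ Finset.range m, f j := by
  rw [uniformDigit, integral_smul_measure, integral_finsetSum_measure]
  · simp [integral_dirac]
  · intro i _
    exact integrable_dirac (by simp)

/-- The `n`-th term of the random series whose law is the Riesz product measure. -/
noncomputable def digitTerm (b d : ℕ → ℕ) (n k : ℕ) : ℝ :=
  ((k % d n : ℕ) : ℝ) / ((d n : ℝ) * (rho b n : ℝ))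

/-- The random series whose law is the Riesz product measure. -/
noncomputable def digitSeries (b d : ℕ → ℕ) (ω : ℕ → ℕ) : ℝ :=
  ∑' n, digitTerm b d n (ω n)

lemma integral_uniformDigit_digitTerm (n : ℕ) (ξ : ℝ) :
    ∫ k, Complex.exp (-2 * Real.pi * Complex.I * ξ * digitTerm b d n k) ∂uniformDigit (d n) =
      H (d n) (ξ / ((d n : ℝ) * (rho b n : ℝ))) := by
  rw [integral_uniformDigit, H]
  congr 1
  refine Finset.sum_congr rfl fun j hj => ?_
  -- The reduction modulo `d n` is invisible to `uniformDigit (d n)`; it makes the series converge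
  -- for every `ω`, not just almost every one.
  rw [digitTerm, Nat.mod_eq_of_lt (Finset.mem_range.1 hj)]
  push_cast
  ring_nf

namespace Admissible

lemma digitTerm_nonneg (n k : ℕ) : 0 ≤ digitTerm b d n k := by
  unfold digitTerm; positivity

lemma digitTerm_le (h : Admissible b d) (n k : ℕ) : digitTerm b d n k ≤ (1 / 4) ^ n := by
  have hr : (0 : ℝ) < rho b n := by exact_mod_cast h.rho_pos n
  have hd : (0 : ℝ) < d n := by exact_mod_cast h.pos n
  have h1 : ((k % d n : ℕ) : ℝ) ≤ d n := by exact_mod_cast (Nat.mod_lt k (h.pos n)).le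
  have h2 : (4 : ℝ) ^ n ≤ rho b n := by
    have := h.four_pow_mul_rho_le 0 n
    simp only [rho, Finset.range_zero, Finset.prod_empty, mul_one, zero_add] at this
    exact_mod_cast this
  rw [digitTerm, div_le_iff₀ (by positivity), one_div, inv_pow]
  calc ((k % d n : ℕ) : ℝ) ≤ d n := h1
    _ = (4 ^ n)⁻¹ * (d n * 4 ^ n) := by field_simp
    _ ≤ _ := by gcongr

lemma summable_digitTerm (h : Admissible b d) (ω : ℕ → ℕ) :
    Summable fun n => digitTerm b d n (ω n) :=
  Summable.of_nonneg_of_le (fun _ => digitTerm_nonneg _ _) (fun n => h.digitTerm_le n (ω n))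
    (summable_geometric_of_lt_one (by norm_num) (by norm_num))

lemma digitSeries_mem_Icc (h : Admissible b d) (ω : ℕ → ℕ) :
    digitSeries b d ω ∈ Set.Icc 0 2 := by
  refine ⟨tsum_nonneg fun _ => digitTerm_nonneg _ _, ?_⟩
  refine ((h.summable_digitTerm ω).tsum_le_tsum (fun n => h.digitTerm_le n (ω n))
    (summable_geometric_of_lt_one (by norm_num) (by norm_num))).trans ?_
  rw [tsum_geometric_of_lt_one (by norm_num) (by norm_num)]
  norm_num

@[fun_prop]
lemma measurable_digitTerm (n : ℕ) : Measurable (digitTerm b d n) :=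
  measurable_of_countable _

lemma measurable_digitSeries (h : Admissible b d) : Measurable (digitSeries b d) := by
  refine measurable_of_tendsto_metrizable
    (f := fun N ω => ∑ n ∈ Finset.range N, digitTerm b d n (ω n)) (fun N => ?_) ?_
  · exact Finset.measurable_fun_sum _ fun n _ =>
      (measurable_digitTerm n).comp (measurable_pi_apply n)
  · rw [tendsto_pi_nhds]
    exact fun ω => (h.summable_digitTerm ω).hasSum.tendsto_sum_nat

lemma exists_isRieszProductMeasure (h : Admissible b d) :
    ∃ μ : Measure ℝ, IsRieszProductMeasure b d μ ∧ μ (Set.Icc 0 2)ᶜ = 0 := by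
  have : ∀ n, NeZero (d n) := fun n => ⟨(h.pos n).ne'⟩
  set P := Measure.infinitePi fun n => uniformDigit (d n) with hP
  have hm := h.measurable_digitSeries
  refine ⟨P.map (digitSeries b d), ⟨Measure.isProbabilityMeasure_map hm.aemeasurable,
    fun ξ => ?_⟩, ?_⟩
  · let e : ℝ → ℂ := fun x => Complex.exp (-2 * Real.pi * Complex.I * ξ * x)
    have hec : Continuous e := by fun_prop
    have hnorm : ∀ x, ‖e x‖ = 1 := fun x => by
      have := norm_cexp_neg_two_pi_I_mul (ξ * x)
      push_cast at this
      rwa [← mul_assoc] at this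
    have hsum : ∀ (s : Finset ℕ) (ω : ℕ → ℕ),
        e (∑ n ∈ s, digitTerm b d n (ω n)) = ∏ n ∈ s, e (digitTerm b d n (ω n)) := by
      intro s ω
      simp only [e]
      rw [← Complex.exp_sum, Complex.ofReal_sum, Finset.mul_sum]
    have hfin : ∀ s : Finset ℕ, ∏ n ∈ s, H (d n) (ξ / ((d n : ℝ) * (rho b n : ℝ))) =
        ∫ ω, e (∑ n ∈ s, digitTerm b d n (ω n)) ∂P := by
      intro s
      have hms : ∀ i : s, AEStronglyMeasurable (fun k => e (digitTerm b d i k))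
          (uniformDigit (d i)) := fun i =>
        (hec.measurable.comp (measurable_digitTerm _)).aestronglyMeasurable
      calc ∏ n ∈ s, H (d n) (ξ / ((d n : ℝ) * (rho b n : ℝ)))
          = ∏ i : s, ∫ k, e (digitTerm b d i k) ∂uniformDigit (d i) := by
            rw [← Finset.prod_coe_sort]
            exact Finset.prod_congr rfl fun i _ => (integral_uniformDigit_digitTerm _ _).symm
        _ = ∫ y : (i : s) → ℕ, ∏ i : s, e (digitTerm b d i (y i))
              ∂Measure.pi fun i : s => uniformDigit (d i) :=
            (integral_fintype_prod_eq_prod (fun (i : s) k => e (digitTerm b d i k))).symm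
        _ = ∫ ω, ∏ i : s, e (digitTerm b d i (s.restrict ω i)) ∂P := by
            refine (integral_restrict_infinitePi (μ := fun n => uniformDigit (d n)) (s := s)
              (f := fun y => ∏ i : s, e (digitTerm b d i (y i))) ?_).symm
            refine (Finset.measurable_fun_prod _ fun i _ => ?_).aestronglyMeasurable
            exact hec.measurable.comp ((measurable_digitTerm _).comp (measurable_pi_apply i))
        _ = _ := by
            refine integral_congr_ae (Filter.Eventually.of_forall fun ω => ?_)
            simp only [hsum, Finset.restrict]
            exact Finset.prod_coe_sort s fun n => e (digitTerm b d n (ω n))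
    have hlim : fourierTransform (P.map (digitSeries b d)) ξ = ∫ ω, e (digitSeries b d ω) ∂P := by
      rw [fourierTransform, integral_map hm.aemeasurable hec.aestronglyMeasurable]
    rw [hlim, HasProd]
    simp_rw [hfin]
    -- The limit runs over all finite sets of indices, as `HasProd` demands unconditional
    -- convergence.
    refine tendsto_integral_filter_of_dominated_convergence (fun _ => 1)
      (Filter.Eventually.of_forall fun s => ?_)
      (Filter.Eventually.of_forall fun s => Filter.Eventually.of_forall fun ω => (hnorm _).le)
      (integrable_const _) (Filter.Eventually.of_forall fun ω => ?_)
    · exact (hec.measurable.comp (Finset.measurable_fun_sum _ fun n _ =>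
        (measurable_digitTerm n).comp (measurable_pi_apply n))).aestronglyMeasurable
    · exact (hec.tendsto _).comp (h.summable_digitTerm ω).hasSum
  · rw [Measure.map_apply hm measurableSet_Icc.compl]
    convert! measure_empty (μ := P)
    ext ω
    simpa using h.digitSeries_mem_Icc ω

end Admissible

lemma IsRieszProductMeasure.unique {μ ν : Measure ℝ} (hμ : IsRieszProductMeasure b d μ)
    (hν : IsRieszProductMeasure b d ν) : μ = ν := by
  have := hμ.1
  have := hν.1
  exact eq_of_fourierTransform_eq fun ξ => (hμ.2 ξ).unique (hν.2 ξ)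

lemma IsRieszProductMeasure.isCompact_support (h : Admissible b d) {μ : Measure ℝ}
    (hμ : IsRieszProductMeasure b d μ) : IsCompact μ.support := by
  obtain ⟨ν, hν, h0⟩ := h.exists_isRieszProductMeasure
  rw [hμ.unique hν]
  exact isCompact_Icc.of_isClosed_subset Measure.isClosed_support
    (Measure.support_subset_of_isClosed isClosed_Icc h0)

/-! ### Tools for completeness. -/

/-- If Parseval's identity holds at `x` for an orthonormal family, then every vector orthogonal to
the family is orthogonal to `x`. -/
lemma inner_eq_zero_of_hasSum_normSq {ι E : Type*} [NormedAddCommGroup E] [InnerProductSpace ℂ E]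
    {v : ι → E} (hv : Orthonormal ℂ v) {x f : E}
    (hx : HasSum (fun i => ‖⟪v i, x⟫_ℂ‖ ^ 2) (‖x‖ ^ 2)) (hf : ∀ i, ⟪f, v i⟫_ℂ = 0) :
    ⟪f, x⟫_ℂ = 0 := by
  -- Cauchy–Schwarz applied to `f` and the remainder of `x` after its finite projection, whose norm
  -- tends to zero by Parseval.
  have key : ∀ s : Finset ι, ‖⟪f, x⟫_ℂ‖ ^ 2 ≤
      ‖f‖ ^ 2 * (‖x‖ ^ 2 - ∑ i ∈ s, ‖⟪v i, x⟫_ℂ‖ ^ 2) := by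
    intro s
    set p := ∑ i ∈ s, ⟪v i, x⟫_ℂ • v i with hp
    have h1 : ⟪f, x⟫_ℂ = ⟪f, x - p⟫_ℂ := by
      rw [inner_sub_right, hp, inner_sum]
      simp [inner_smul_right, hf]
    have h2 : ⟪p, x - p⟫_ℂ = 0 := by
      rw [hp, sum_inner]
      refine Finset.sum_eq_zero fun i hi => ?_
      rw [inner_smul_left, inner_sub_right, hv.inner_right_sum _ hi, sub_self, mul_zero]
    have h3 : ‖p‖ ^ 2 = ∑ i ∈ s, ‖⟪v i, x⟫_ℂ‖ ^ 2 := by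
      have := hv.inner_sum (fun i => ⟪v i, x⟫_ℂ) (fun i => ⟪v i, x⟫_ℂ) s
      rw [← hp, inner_self_eq_norm_sq_to_K] at this
      simp_rw [Complex.conj_mul'] at this
      refine Complex.ofReal_injective ?_
      push_cast
      exact this
    have h4 : ‖x‖ ^ 2 = ‖p‖ ^ 2 + ‖x - p‖ ^ 2 := by
      have := norm_add_sq_eq_norm_sq_add_norm_sq_of_inner_eq_zero p (x - p) h2
      rw [add_sub_cancel] at this
      simpa [sq] using this
    rw [h4, h3, add_sub_cancel_left, h1, ← mul_pow]
    gcongr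
    exact norm_inner_le_norm _ _
  have hlim : Filter.Tendsto
      (fun s : Finset ι => ‖f‖ ^ 2 * (‖x‖ ^ 2 - ∑ i ∈ s, ‖⟪v i, x⟫_ℂ‖ ^ 2)) Filter.atTop
      (𝓝 (‖f‖ ^ 2 * (‖x‖ ^ 2 - ‖x‖ ^ 2))) := (tendsto_const_nhds.sub hx).const_mul _
  have := ge_of_tendsto' hlim key
  rw [sub_self, mul_zero] at this
  simpa using this.antisymm (by positivity)

/-- A real integrable function whose Fourier transform with respect to `μ` vanishes is zero. -/
lemma ae_eq_zero_of_integral_exp_mul_ofReal_eq_zero {μ : Measure ℝ} [IsFiniteMeasure μ]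
    {g : ℝ → ℝ} (hg : Integrable g μ)
    (h : ∀ t : ℝ, ∫ x, Complex.exp (t * x * Complex.I) * (g x : ℂ) ∂μ = 0) : g =ᵐ[μ] 0 := by
  have hp : AEMeasurable (fun x => ENNReal.ofReal (g x)) μ := hg.aemeasurable.ennreal_ofReal
  have hn : AEMeasurable (fun x => ENNReal.ofReal (-g x)) μ := hg.neg.aemeasurable.ennreal_ofReal
  have : IsFiniteMeasure (μ.withDensity fun x => ENNReal.ofReal (g x)) :=
    isFiniteMeasure_withDensity_ofReal hg.2
  have : IsFiniteMeasure (μ.withDensity fun x => ENNReal.ofReal (-g x)) :=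
    isFiniteMeasure_withDensity_ofReal hg.neg.2
  have hint : ∀ (t : ℝ) {u : ℝ → ℝ}, Integrable u μ →
      Integrable (fun x : ℝ => Complex.exp (t * x * Complex.I) * (u x : ℂ)) μ := by
    intro t u hu
    refine hu.ofReal.bdd_mul (c := 1) (by fun_prop) (Filter.Eventually.of_forall fun x : ℝ => ?_)
    have := Complex.norm_exp_ofReal_mul_I (t * x)
    push_cast at this
    exact this.le
  have hchar : ∀ (t : ℝ) {u : ℝ → ℝ}, Integrable u μ →
      charFun (μ.withDensity fun x => ENNReal.ofReal (u x)) t =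
        ∫ x, Complex.exp (t * x * Complex.I) * ((max (u x) 0 : ℝ) : ℂ) ∂μ := by
    intro t u hu
    rw [charFun_apply_real, integral_withDensity_eq_integral_toReal_smul₀
      hu.aemeasurable.ennreal_ofReal (Filter.Eventually.of_forall fun _ => ENNReal.ofReal_lt_top)]
    refine integral_congr_ae (Filter.Eventually.of_forall fun x => ?_)
    simp only [ENNReal.toReal_ofReal', Complex.real_smul]
    rw [mul_comm]
  -- The positive and negative parts of `g` are densities of finite measures with equal
  -- characteristic functions.
  have heq : (μ.withDensity fun x => ENNReal.ofReal (g x)) =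
      μ.withDensity fun x => ENNReal.ofReal (-g x) := by
    refine Measure.ext_of_charFun (funext fun t => ?_)
    rw [hchar t hg, hchar t (u := fun x => -g x) hg.neg, ← sub_eq_zero,
      ← integral_sub (hint t hg.pos_part) (hint t hg.neg_part), ← h t]
    refine integral_congr_ae (Filter.Eventually.of_forall fun x => ?_)
    simp only
    rw [← mul_sub, ← Complex.ofReal_sub]
    congr 2
    exact posPart_sub_negPart (g x)
  have := (withDensity_eq_iff hp hn hg.lintegral_lt_top.ne).1 heq
  filter_upwards [this] with x hx
  rcases le_total (g x) 0 with h0 | h0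
  · rw [ENNReal.ofReal_of_nonpos h0] at hx
    have := ENNReal.ofReal_eq_zero.1 hx.symm
    simp only [Pi.zero_apply]
    linarith
  · rw [ENNReal.ofReal_of_nonpos (p := -g x) (by linarith)] at hx
    exact (ENNReal.ofReal_eq_zero.1 hx).antisymm h0

/-- An integrable function whose Fourier transform with respect to `μ` vanishes is zero. -/
lemma ae_eq_zero_of_integral_exp_mul_eq_zero {μ : Measure ℝ} [IsFiniteMeasure μ]
    {f : ℝ → ℂ} (hf : Integrable f μ)
    (h : ∀ t : ℝ, ∫ x, Complex.exp (t * x * Complex.I) * f x ∂μ = 0) : f =ᵐ[μ] 0 := by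
  have hbdd : ∀ t : ℝ, ∀ᵐ x : ℝ ∂μ, ‖Complex.exp (t * x * Complex.I)‖ ≤ 1 := fun t =>
    Filter.Eventually.of_forall fun x => by
      have := Complex.norm_exp_ofReal_mul_I (t * x)
      push_cast at this
      exact this.le
  have hint : ∀ t : ℝ, Integrable (fun x : ℝ => Complex.exp (t * x * Complex.I) * f x) μ :=
    fun t => hf.bdd_mul (by fun_prop) (hbdd t)
  have hfc : Integrable (fun x => conj (f x)) μ :=
    (integrable_norm_iff (Complex.continuous_conj.comp_aestronglyMeasurable hf.1)).1
      (by simpa using hf.norm)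
  have hintc : ∀ t : ℝ, Integrable (fun x : ℝ => Complex.exp (t * x * Complex.I) * conj (f x)) μ :=
    fun t => hfc.bdd_mul (by fun_prop) (hbdd t)
  -- Conjugating the hypothesis at `-t` lets the real and imaginary parts be treated separately.
  have hc : ∀ t : ℝ, ∫ x, Complex.exp (t * x * Complex.I) * conj (f x) ∂μ = 0 := by
    intro t
    have := congrArg conj (h (-t))
    rw [← integral_conj, map_zero] at this
    rw [← this]
    refine integral_congr_ae (Filter.Eventually.of_forall fun x => ?_)
    simp [← Complex.exp_conj]
  have hre : (fun x => (f x).re) =ᵐ[μ] 0 := by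
    refine ae_eq_zero_of_integral_exp_mul_ofReal_eq_zero hf.re fun t => ?_
    have : ∀ x : ℝ, Complex.exp (t * x * Complex.I) * ((f x).re : ℂ) =
        (1 / 2) * (Complex.exp (t * x * Complex.I) * f x +
          Complex.exp (t * x * Complex.I) * conj (f x)) := fun x => by
      rw [Complex.re_eq_add_conj]; ring
    simp_rw [this]
    rw [integral_const_mul, integral_add (hint t) (hintc t), h, hc]
    simp
  have him : (fun x => (f x).im) =ᵐ[μ] 0 := by
    refine ae_eq_zero_of_integral_exp_mul_ofReal_eq_zero hf.im fun t => ?_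
    have : ∀ x : ℝ, Complex.exp (t * x * Complex.I) * ((f x).im : ℂ) =
        (1 / (2 * Complex.I)) * (Complex.exp (t * x * Complex.I) * f x -
          Complex.exp (t * x * Complex.I) * conj (f x)) := fun x => by
      rw [Complex.im_eq_sub_conj]; ring
    simp_rw [this]
    rw [integral_const_mul, integral_sub (hint t) (hintc t), h, hc]
    simp
  filter_upwards [hre, him] with x h1 h2
  exact Complex.ext h1 h2

/-- The exponential of frequency `t` as an element of `L²`. -/
noncomputable def expLp (μ : Measure ℝ) [IsFiniteMeasure μ] (t : ℝ) : Lp ℂ 2 μ :=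
  MemLp.toLp (fun x : ℝ => Complex.exp (-2 * Real.pi * Complex.I * t * x))
    (MemLp.of_bound (C := 1) (by fun_prop) (Filter.Eventually.of_forall fun x => by
      have := norm_cexp_neg_two_pi_I_mul (t * x)
      push_cast at this
      rw [← mul_assoc] at this
      exact this.le))

section expLp

variable {μ : Measure ℝ} [IsFiniteMeasure μ]

lemma coeFn_expLp (t : ℝ) : (expLp μ t : ℝ → ℂ) =ᵐ[μ]
    fun x : ℝ => Complex.exp (-2 * Real.pi * Complex.I * t * x) :=
  MemLp.coeFn_toLp _

lemma inner_expLp (s t : ℝ) : ⟪expLp μ s, expLp μ t⟫_ℂ = fourierTransform μ (t - s) := by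
  rw [L2.inner_def, fourierTransform]
  refine integral_congr_ae ?_
  filter_upwards [coeFn_expLp (μ := μ) s, coeFn_expLp (μ := μ) t] with x hs ht
  rw [hs, ht, RCLike.inner_apply', ← Complex.exp_conj, ← Complex.exp_add]
  congr 1
  simp [show (starRingEnd ℂ) 2 = 2 from Complex.conj_ofNat 2]
  ring

/-- As `μ` is finite, `f` is integrable, and the hypothesis says that the Fourier transform of `f
dμ` vanishes. -/
lemma eq_zero_of_inner_expLp_eq_zero {f : Lp ℂ 2 μ} (h : ∀ t, ⟪f, expLp μ t⟫_ℂ = 0) : f = 0 := by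
  rw [Lp.eq_zero_iff_ae_eq_zero]
  refine ae_eq_zero_of_integral_exp_mul_eq_zero ((Lp.memLp f).integrable (by norm_num)) fun t => ?_
  have h1 := h (t / (2 * Real.pi))
  rw [← inner_conj_symm, map_eq_zero, L2.inner_def] at h1
  rw [← h1]
  refine integral_congr_ae ?_
  filter_upwards [coeFn_expLp (μ := μ) (t / (2 * Real.pi))] with x hx
  rw [hx, RCLike.inner_apply', ← Complex.exp_conj]
  congr 2
  have hp : (Real.pi : ℂ) ≠ 0 := by exact_mod_cast Real.pi_pos.ne'
  simp [show (starRingEnd ℂ) 2 = 2 from Complex.conj_ofNat 2]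
  field_simp

end expLp

/-! ### The spectrum of the Riesz product measure. -/

variable {μ : Measure ℝ}

namespace IsRieszProductMeasure

lemma tendsto_partialProd (hμ : IsRieszProductMeasure b d μ) (ξ : ℝ) :
    Filter.Tendsto (fun N => partialProd b d N ξ) Filter.atTop (𝓝 (fourierTransform μ ξ)) :=
  (hμ.2 ξ).tendsto_prod_nat

lemma norm_fourierTransform_le (hμ : IsRieszProductMeasure b d μ) (L : ℕ) (ξ : ℝ) :
    ‖fourierTransform μ ξ‖ ≤ ‖partialProd b d L ξ‖ := by
  refine le_of_tendsto (hμ.tendsto_partialProd ξ).norm ?_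
  filter_upwards [Filter.eventually_ge_atTop L] with N hN
  obtain ⟨k, rfl⟩ := Nat.exists_eq_add_of_le hN
  exact Admissible.norm_partialProd_add_le L k ξ

lemma norm_partialProd_le (h : Admissible b d) (hμ : IsRieszProductMeasure b d μ) (L : ℕ) {ξ : ℝ}
    (hξ : |ξ| ≤ 3 / 5 * rho b L) : ‖partialProd b d L ξ‖ ≤ 5 * ‖fourierTransform μ ξ‖ := by
  suffices 1 / 5 * ‖partialProd b d L ξ‖ ≤ ‖fourierTransform μ ξ‖ by linarith
  refine ge_of_tendsto (hμ.tendsto_partialProd ξ).norm ?_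
  filter_upwards [Filter.eventually_ge_atTop L] with N hN
  obtain ⟨k, rfl⟩ := Nat.exists_eq_add_of_le hN
  refine le_trans ?_ (h.mul_norm_partialProd_le L hξ k)
  gcongr
  linarith [show (0 : ℝ) ≤ 2 / 5 * (1 / 16) ^ k by positivity]

lemma fourierTransform_sub_eq_zero (h : Admissible b d) (hμ : IsRieszProductMeasure b d μ)
    {L L' l l' : ℕ} (hl : l ∈ digitSums b d L) (hl' : l' ∈ digitSums b d L') (hne : l ≠ l') :
    fourierTransform μ ((l : ℝ) - l') = 0 := by
  have h1 := h.partialProd_sub_eq_zero (h.digitSums_mono (le_max_left L L') hl)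
    (h.digitSums_mono (le_max_right L L') hl') hne
  have h2 := hμ.norm_fourierTransform_le (max L L') ((l : ℝ) - l')
  rw [h1, norm_zero] at h2
  exact norm_le_zero_iff.1 h2

lemma fourierTransform_zero (hμ : IsRieszProductMeasure b d μ) : fourierTransform μ 0 = 1 := by
  have := hμ.1
  simp [fourierTransform]

lemma norm_expLp [IsFiniteMeasure μ] (hμ : IsRieszProductMeasure b d μ) (t : ℝ) :
    ‖expLp μ t‖ = 1 := by
  have h1 := inner_self_eq_norm_sq_to_K (𝕜 := ℂ) (expLp μ t)
  rw [inner_expLp, sub_self, hμ.fourierTransform_zero] at h1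
  have h2 : ‖expLp μ t‖ ^ 2 = 1 := by
    refine Complex.ofReal_injective ?_
    push_cast
    exact h1.symm
  exact (pow_eq_one_iff_of_nonneg (norm_nonneg _) two_ne_zero).1 h2

lemma orthonormal_expLp [IsFiniteMeasure μ] (h : Admissible b d) (hμ : IsRieszProductMeasure b d μ)
    {ι : Type*} {u : ι → ℕ} (hu : Function.Injective u) (hmem : ∀ i, ∃ L, u i ∈ digitSums b d L) :
    Orthonormal ℂ fun i => expLp μ (u i) := by
  refine ⟨fun i => hμ.norm_expLp _, fun i j hij => ?_⟩
  obtain ⟨L, hL⟩ := hmem i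
  obtain ⟨L', hL'⟩ := hmem j
  simp only [inner_expLp]
  exact hμ.fourierTransform_sub_eq_zero h hL' hL (hu.ne hij.symm)

/-- The finite identities at `-x`, extended by zero to `ℕ`, converge termwise. They are eventually
dominated by `25` times the limit terms, which are summable by Bessel's inequality. -/
lemma hasSum_normSq_inner_expLp [IsFiniteMeasure μ] (h : Admissible b d)
    (hμ : IsRieszProductMeasure b d μ) (x : ℝ) :
    HasSum (fun l : {l : ℕ | ∃ L, l ∈ digitSums b d L} => ‖⟪expLp μ (l : ℕ), expLp μ x⟫_ℂ‖ ^ 2)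
      1 := by
  classical
  set Λ : Set ℕ := {l : ℕ | ∃ L, l ∈ digitSums b d L} with hΛ
  set g : ℕ → ℝ := fun l => ‖fourierTransform μ (x - l)‖ ^ 2 with hg
  have hsub : ∀ y z : ℝ, ‖fourierTransform μ (y - z)‖ = ‖fourierTransform μ (z - y)‖ := by
    intro y z
    rw [← inner_expLp, ← inner_expLp, norm_inner_symm]
  have hsum : Summable (Λ.indicator g) := by
    rw [← summable_subtype_iff_indicator]
    have := (hμ.orthonormal_expLp h (u := ((↑) : Λ → ℕ)) Subtype.val_injective
      fun l => l.2).inner_products_summable (x := expLp μ x)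
    simp_rw [inner_expLp] at this
    exact this
  simp_rw [inner_expLp]
  change HasSum (g ∘ ((↑) : Λ → ℕ)) 1
  rw [hasSum_subtype_iff_indicator]
  let f : ℕ → ℕ → ℝ := fun L l =>
    if l ∈ digitSums b d L then ‖partialProd b d L (-x + l)‖ ^ 2 else 0
  have hf : ∀ L, ∑' l, f L l = 1 := by
    intro L
    rw [tsum_eq_sum (s := digitSums b d L) fun l hl => if_neg hl, ← h.sum_normSq_partialProd L (-x)]
    exact Finset.sum_congr rfl fun l hl => if_pos hl
  have hlim : Filter.Tendsto (fun L => ∑' l, f L l) Filter.atTop (𝓝 (∑' l, Λ.indicator g l)) := by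
    refine tendsto_tsum_of_dominated_convergence (hsum.mul_left 25) (fun l => ?_) ?_
    · by_cases hl : l ∈ Λ
      · rw [Set.indicator_of_mem hl]
        obtain ⟨L₀, hL₀⟩ := hl
        refine Filter.Tendsto.congr' (f₁ := fun L => ‖partialProd b d L (-x + l)‖ ^ 2) ?_ ?_
        · filter_upwards [Filter.eventually_ge_atTop L₀] with L hL
          exact (if_pos (h.digitSums_mono hL hL₀)).symm
        · simp only [hg]
          rw [hsub, ← neg_add_eq_sub]
          exact (hμ.tendsto_partialProd _).norm.pow 2
      · rw [Set.indicator_of_notMem hl]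
        refine Filter.Tendsto.congr (f₁ := fun _ => 0) (fun L => ?_) tendsto_const_nhds
        exact (if_neg fun hL => hl ⟨L, hL⟩).symm
    -- This makes `|x| ≤ rho b L / 10`; with `l ≤ rho b L / 2` the sum is at most `3 / 5 * rho b L`.
    · have hρ : ∀ᶠ L in Filter.atTop, 10 * |x| ≤ (4 : ℝ) ^ L :=
        (tendsto_pow_atTop_atTop_of_one_lt (by norm_num)).eventually_ge_atTop _
      filter_upwards [hρ] with L hL l
      by_cases hl : l ∈ digitSums b d L
      · have h1 : (4 : ℝ) ^ L ≤ rho b L := by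
          have := h.four_pow_mul_rho_le 0 L
          simp only [rho, Finset.range_zero, Finset.prod_empty, mul_one, zero_add] at this
          exact_mod_cast this
        have h2 : 2 * (l : ℝ) ≤ rho b L := by exact_mod_cast h.two_mul_le_rho hl
        have h3 : |-x + l| ≤ 3 / 5 * rho b L := by
          refine (abs_add_le _ _).trans ?_
          rw [abs_neg, Nat.abs_cast]
          linarith
        have h4 := hμ.norm_partialProd_le h L h3
        simp only [f, if_pos hl]
        rw [Set.indicator_of_mem (show l ∈ Λ from ⟨L, hl⟩), Real.norm_of_nonneg (by positivity)]
        simp only [hg]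
        rw [hsub, ← neg_add_eq_sub]
        calc ‖partialProd b d L (-x + l)‖ ^ 2 ≤ (5 * ‖fourierTransform μ (-x + l)‖) ^ 2 := by gcongr
          _ = _ := by ring
      · simp only [f, if_neg hl, norm_zero]
        exact mul_nonneg (by norm_num) (Set.indicator_nonneg (fun _ _ => by positivity) _)
  simp_rw [hf] at hlim
  rw [tendsto_nhds_unique tendsto_const_nhds hlim]
  exact hsum.hasSum

lemma isSpectrum (h : Admissible b d) (hμ : IsRieszProductMeasure b d μ) :
    IsSpectrum μ (spectralSet b d) := by
  have := hμ.1
  refine ⟨hμ.1, hμ.isCompact_support h, ?_, ?_⟩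
  · refine (Set.countable_range (Nat.cast : ℕ → ℝ)).mono fun x hx => ?_
    obtain ⟨-, l, -, rfl⟩ := (Admissible.mem_spectralSet_iff h).1 hx
    exact ⟨l, rfl⟩
  · have hΛ : ∀ l : spectralSet b d, ∃ n : ℕ, (l : ℝ) = n ∧ ∃ L, n ∈ digitSums b d L := by
      intro l
      obtain ⟨L, n, hn, hl⟩ := (Admissible.mem_spectralSet_iff h).1 l.2
      exact ⟨n, hl, L, hn⟩
    choose u hu hmem using hΛ
    have huinj : Function.Injective u := fun l l' hll' => Subtype.ext (by rw [hu, hu, hll'])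
    have horth : Orthonormal ℂ fun l : spectralSet b d => expLp μ l := by
      simp_rw [hu]
      exact hμ.orthonormal_expLp h huinj hmem
    have htop : (Submodule.span ℂ (Set.range fun l : spectralSet b d => expLp μ l))ᗮ = ⊥ := by
      rw [Submodule.eq_bot_iff]
      intro f hf
      rw [Submodule.mem_orthogonal'] at hf
      -- By Parseval at `expLp μ t`, orthogonality to the frequencies in the spectral set passes to
      -- every real frequency `t`.
      refine eq_zero_of_inner_expLp_eq_zero fun t => ?_
      refine inner_eq_zero_of_hasSum_normSq
        (hμ.orthonormal_expLp h (u := ((↑) : {l : ℕ | ∃ L, l ∈ digitSums b d L} → ℕ))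
          Subtype.val_injective fun l => l.2) ?_ fun l => ?_
      · rw [hμ.norm_expLp, one_pow]
        exact hμ.hasSum_normSq_inner_expLp h t
      · obtain ⟨L, hL⟩ := l.2
        exact hf _ (Submodule.subset_span
          ⟨⟨(l : ℕ), (Admissible.mem_spectralSet_iff h).2 ⟨L, l, hL, rfl⟩⟩, rfl⟩)
    refine ⟨HilbertBasis.mkOfOrthogonalEqBot horth htop, fun l => ?_⟩
    rw [HilbertBasis.coe_mkOfOrthogonalEqBot]
    exact coeFn_expLp _

end IsRieszProductMeasure

end RieszSpectral

theorem theorem1p1 (b d : ℕ → ℕ)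
    (hbd : ∀ n, 1 < d n ∧ d n < b n)
    (hdiv : ∀ n, d n ∣ b n ∧ 2 ≤ b n / d n) :
    (∃! μ : Measure ℝ, RieszSpectral.IsRieszProductMeasure b d μ) ∧
      ∀ μ : Measure ℝ, RieszSpectral.IsRieszProductMeasure b d μ →
        RieszSpectral.IsSpectrum μ (RieszSpectral.spectralSet b d) := by
  have h : RieszSpectral.Admissible b d :=
    ⟨fun n => (hbd n).1, fun n => (hdiv n).1, fun n =>
      (Nat.le_div_iff_mul_le (zero_lt_one.trans (hbd n).1)).1 (hdiv n).2⟩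
  obtain ⟨μ, hμ, -⟩ := h.exists_isRieszProductMeasure
  exact ⟨⟨μ, hμ, fun ν hν => hν.unique hμ⟩, fun ν hν => hν.isSpectrum h⟩
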